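/- Let $p$ be a prime and let $G$ be a finite $p$-group of nilpotency class $2$ that has a cyclic maximal subgroup. For a word $w$ in $k\ge 0$ variables (an element of the free group on $x_1,\dots,x_k$) and $g\in G$, write $$P_{w,G}(g)=\frac{\bigl|\{(g_1,\dots,g_k)\in G^k : w(g_1,\dots,g_k)=g\}\bigr|}{|G|^k},\qquad G_w=\{w(g_1,\dots,g_k) : g_1,\dots,g_k\in G\}.$$ Then $G$ satisfies the Amit--Ashurst conjecture, that is, for every $k\ge 0$, every word $w$ in $k$ variables and every $g\in G_w$, $$P_{w,G}(g)\ \ge\ \frac{1}{|G|}.$$ Moreover, $G$ is isomorphic to the quaternion group $Q_8$ of order $8$, or there is an integer $n\ge 2$ such that $$G\cong\langle a,b \mid a^{p^n}=b^p=1,\ bab^{-1}=a^{1+p^{n-1}}\rangle .$$ -/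

import Mathlib

/-- The word map `G^k → G` of a word `w` in `k` variables: substitute `x i` for the `i`-th
free generator. -/
def wordMap {G : Type*} [Group G] {k : ℕ} (w : FreeGroup (Fin k)) (x : Fin k → G) : G :=
  FreeGroup.lift x w

/-- The set `G_w` of values of the word `w` in `G`. -/
def wordValues (G : Type*) [Group G] {k : ℕ} (w : FreeGroup (Fin k)) : Set G :=
  Set.range (wordMap w : (Fin k → G) → G)

/-- `N_{w,G}(g)`, the number of solutions of `w = g` in `G^k`. -/
noncomputable def wordCount {G : Type*} [Group G] {k : ℕ} (w : FreeGroup (Fin k)) (g : G) : ℕ :=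
  Nat.card {x : Fin k → G // wordMap w x = g}

/-- `P_{w,G}(g) = N_{w,G}(g) / |G|^k` (used for finite `G`). -/
noncomputable def wordProb {G : Type*} [Group G] {k : ℕ} (w : FreeGroup (Fin k)) (g : G) : ℚ :=
  (wordCount w g : ℚ) / (Nat.card G : ℚ) ^ k

/-- The finite group `G` satisfies the Amit-Ashurst conjecture: `P_{w,G}(g) ≥ |G|⁻¹` for every
word `w`, in any number of variables, and every value `g` of `w` in `G`. -/
def SatisfiesAmitAshurst (G : Type*) [Group G] : Prop :=
  ∀ (k : ℕ) (w : FreeGroup (Fin k)) (g : G), g ∈ wordValues G w →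
    wordProb w g ≥ (Nat.card G : ℚ)⁻¹

/-- The relators of `⟨a, b ∣ a^(p^n) = b^p = 1, b a b⁻¹ = a^(1 + p^(n-1))⟩`, where `a` and `b`
are the free generators with index `0` and `1` (used for `n ≥ 2`). -/
def modularRels (p n : ℕ) : Set (FreeGroup (Fin 2)) :=
  {FreeGroup.of 0 ^ p ^ n,
   FreeGroup.of 1 ^ p,
   FreeGroup.of 1 * FreeGroup.of 0 * (FreeGroup.of 1)⁻¹ *
     (FreeGroup.of 0 ^ (1 + p ^ (n - 1)))⁻¹}

/-- The group `⟨a, b ∣ a^(p^n) = b^p = 1, b a b⁻¹ = a^(1 + p^(n-1))⟩`. -/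
abbrev ModularGroup (p n : ℕ) : Type := PresentedGroup (modularRels p n)

/-!
The group is generated by `a`, with `⟨a⟩` cyclic of order `p ^ n` and index `p`, and an element
`b` outside it. As the class is two, commutators are bimultiplicative and central, and they lie in
the subgroup `Ω` of order `p` of `⟨a⟩`. Replacing `b` by a power and then by a product with a power
of `a` gives `⁅b, a⁆ = a ^ p ^ (n - 1)` and `b ^ p ∈ Ω` (`exists_isModularPair`). Everything is
deduced from such a pair of generators.

*Word maps.* Let `w` be a word in `k` variables. Up to a factor in `Ω` which is multiplicative in
each argument, `w` is a homomorphism `G ^ k → G` (`exists_wordMap_mul_eq`).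

If `p` does not divide the exponent sum of some variable, then `w` is a bijection in that variable
for all values of the others, so all fibres have `|G| ^ (k - 1)` elements
(`card_le_of_isCoprime_expSum`).

If `p` divides every exponent sum, write a point of `G ^ k` as `y d`, where `y` is a tuple of powers
of `b` and `d` a tuple of powers of `a`. Then `w (y d) = w (y) φ_y(d)` for a homomorphism `φ_y` to
`⟨a⟩`, which has a kernel of index at most `|⟨a⟩|`; and `w (y)` lies in `Ω` because `b ^ p` does.
Since the subgroups of `⟨a⟩` form a chain, the value attained at `y₀ d₀` is also attained in the
coset of `y` whenever `y` and `y₀` agree under a suitable homomorphism to `Ω`, that is, for a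
proportion of at least `1 / p` of all `y`. Altogether a proportion of at least
`1 / (p |⟨a⟩|) = 1 / |G|` of all points are solutions (`card_le_of_dvd_expSum`).

*Classification.* If `b ^ p = 1`, the relations of the presentation hold, and comparing normal forms
shows that they suffice. This is the case for odd `p`, where `p` divides `p choose 2`. If `p = 2`
and `b ^ 2` is the involution of `⟨a⟩`, then for `n ≥ 3` another choice of `b` has square one
(`IsModularPair.exists_sq_eq_one`), and for `n = 2` the relations are those of the quaternion
group.
-/

open scoped commutatorElement IsMulCommutative

/-! ### Words in groups of class two -/

section Class2

variable {G : Type*} [Group G]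

theorem mul_comm_of_mem_center {c : G} (hc : c ∈ Subgroup.center G) (g : G) : g * c = c * g :=
  Subgroup.mem_center_iff.mp hc g

theorem commutatorElement_mul_left_of_center
    (hc : ∀ u v : G, ⁅u, v⁆ ∈ Subgroup.center G) (u u' v : G) :
    ⁅u * u', v⁆ = ⁅u, v⁆ * ⁅u', v⁆ := by
  have h := mul_comm_of_mem_center (hc u' v) u
  calc ⁅u * u', v⁆ = u * ⁅u', v⁆ * u⁻¹ * ⁅u, v⁆ := by simp only [commutatorElement_def]; group
    _ = ⁅u', v⁆ * ⁅u, v⁆ := by rw [h]; group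
    _ = ⁅u, v⁆ * ⁅u', v⁆ := mul_comm_of_mem_center (hc u v) _

theorem commutatorElement_mul_right_of_center
    (hc : ∀ u v : G, ⁅u, v⁆ ∈ Subgroup.center G) (u v v' : G) :
    ⁅u, v * v'⁆ = ⁅u, v⁆ * ⁅u, v'⁆ := by
  rw [← commutatorElement_inv, commutatorElement_mul_left_of_center hc, mul_inv_rev,
    commutatorElement_inv, commutatorElement_inv]
  exact mul_comm_of_mem_center (hc u v) _

theorem commutatorElement_zpow_left_of_center
    (hc : ∀ u v : G, ⁅u, v⁆ ∈ Subgroup.center G) (u v : G) (n : ℤ) :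
    ⁅u ^ n, v⁆ = ⁅u, v⁆ ^ n :=
  map_zpow (MonoidHom.mk' (fun u => ⁅u, v⁆)
    fun u u' => commutatorElement_mul_left_of_center hc u u' v) u n

theorem commutatorElement_pow_left_of_center
    (hc : ∀ u v : G, ⁅u, v⁆ ∈ Subgroup.center G) (u v : G) (n : ℕ) :
    ⁅u ^ n, v⁆ = ⁅u, v⁆ ^ n := by
  simpa using commutatorElement_zpow_left_of_center hc u v n

theorem commutatorElement_pow_right_of_center
    (hc : ∀ u v : G, ⁅u, v⁆ ∈ Subgroup.center G) (u v : G) (n : ℕ) :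
    ⁅u, v ^ n⁆ = ⁅u, v⁆ ^ n := by
  rw [← commutatorElement_inv, commutatorElement_pow_left_of_center hc, ← inv_pow,
    commutatorElement_inv]

theorem mul_pow_of_commutator_center
    (hc : ∀ u v : G, ⁅u, v⁆ ∈ Subgroup.center G) (u v : G) (n : ℕ) :
    (u * v) ^ n = u ^ n * v ^ n * ⁅v, u⁆ ^ n.choose 2 := by
  induction n with
  | zero => simp
  | succ n ih =>
    have hz : ∀ m : ℕ, ∀ g : G, g * ⁅v, u⁆ ^ m = ⁅v, u⁆ ^ m * g := fun m g =>
      mul_comm_of_mem_center (Subgroup.pow_mem _ (hc v u) m) g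
    have hswap : v ^ n * u = u * v ^ n * ⁅v, u⁆ ^ n := by
      rw [hz, ← commutatorElement_pow_left_of_center hc, commutatorElement_def]; group
    have hch : (n + 1).choose 2 = n + n.choose 2 := by
      rw [Nat.choose_succ_succ' n 1, Nat.choose_one_right]
    calc (u * v) ^ (n + 1) = u ^ n * v ^ n * ⁅v, u⁆ ^ n.choose 2 * (u * v) := by rw [pow_succ, ih]
      _ = ⁅v, u⁆ ^ n.choose 2 * (u ^ n * (v ^ n * u) * v) := by rw [hz]; group
      _ = ⁅v, u⁆ ^ n.choose 2 * (u ^ n * u * v ^ n * (⁅v, u⁆ ^ n * v)) := by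
        simp only [hswap, mul_assoc]
      _ = ⁅v, u⁆ ^ n.choose 2 * ((u ^ n * u * v ^ n * v) * ⁅v, u⁆ ^ n) := by
        rw [← hz n v]; simp only [mul_assoc]
      _ = (u ^ n * u * v ^ n * v) * (⁅v, u⁆ ^ n * ⁅v, u⁆ ^ n.choose 2) := by
        rw [← hz (n.choose 2)]; simp only [mul_assoc]
      _ = u ^ (n + 1) * v ^ (n + 1) * ⁅v, u⁆ ^ (n + 1).choose 2 := by
        rw [hch, pow_add ⁅v, u⁆, pow_succ u, pow_succ v]; simp only [mul_assoc]

/-- A word map on a group of class two is a homomorphism up to a central factor which is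
multiplicative in each argument: the property of being such a map is inherited by products of
words, the new factor being the commutator of values, on which central factors have no
influence. -/
theorem exists_wordMap_mul_eq {Ω : Subgroup G} (hΩ : Ω ≤ Subgroup.center G)
    (hcomm : ∀ u v : G, ⁅u, v⁆ ∈ Ω) {k : ℕ} (w : FreeGroup (Fin k)) :
    ∃ γ : (Fin k → G) → (Fin k → G) → G, (∀ x y, γ x y ∈ Ω) ∧
      (∀ x x' y, γ (x * x') y = γ x y * γ x' y) ∧
      (∀ x y y', γ x (y * y') = γ x y * γ x y') ∧
      ∀ x y, wordMap w (x * y) = wordMap w x * wordMap w y * γ x y := by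
  have hc : ∀ u v : G, ⁅u, v⁆ ∈ Subgroup.center G := fun u v => hΩ (hcomm u v)
  have hz : ∀ {c : G}, c ∈ Ω → ∀ g, g * c = c * g := fun h g => mul_comm_of_mem_center (hΩ h) g
  -- central factors do not change commutators
  have hcl : ∀ {c : G}, c ∈ Ω → ∀ u v, ⁅u * c, v⁆ = ⁅u, v⁆ := fun h u v => by
    rw [commutatorElement_mul_left_of_center hc,
      commutatorElement_eq_one_iff_mul_comm.mpr (hz h v).symm, mul_one]
  have hcr : ∀ {c : G}, c ∈ Ω → ∀ u v, ⁅u, v * c⁆ = ⁅u, v⁆ := fun h u v => by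
    rw [commutatorElement_mul_right_of_center hc,
      commutatorElement_eq_one_iff_mul_comm.mpr (hz h u), mul_one]
  induction w using FreeGroup.induction_on with
  | C1 => exact ⟨fun _ _ => 1, by simp [Ω.one_mem], by simp, by simp, by simp [wordMap]⟩
  | of i => exact ⟨fun _ _ => 1, by simp [Ω.one_mem], by simp, by simp, by simp [wordMap]⟩
  | inv_of i _ =>
    refine ⟨fun x y => ⁅y i, x i⁆, fun x y => hcomm _ _, fun x x' y => ?_, fun x y y' => ?_,
      fun x y => ?_⟩
    · exact commutatorElement_mul_right_of_center hc _ _ _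
    · exact commutatorElement_mul_left_of_center hc _ _ _
    · rw [hz (hcomm _ _)]
      simp only [wordMap, map_inv, FreeGroup.lift_apply_of, Pi.mul_apply, commutatorElement_def]
      have h2 : ⁅(y i)⁻¹, (x i)⁻¹⁆ = ⁅y i, x i⁆ := by
        have e1 : ⁅(y i)⁻¹, (x i)⁻¹⁆ * ⁅y i, (x i)⁻¹⁆ = 1 := by
          rw [← commutatorElement_mul_left_of_center hc]; simp
        have e2 : ⁅y i, (x i)⁻¹⁆ * ⁅y i, x i⁆ = 1 := by
          rw [← commutatorElement_mul_right_of_center hc]; simp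
        exact (eq_inv_of_mul_eq_one_left e1).trans (eq_inv_of_mul_eq_one_right e2).symm
      rw [← commutatorElement_def, ← h2, commutatorElement_def]
      group
  | mul u v hu hv =>
    obtain ⟨γ, hm, hl, hr, hw⟩ := hu
    obtain ⟨γ', hm', hl', hr', hw'⟩ := hv
    have hz' : ∀ x y g, g * γ x y = γ x y * g := fun x y => hz (hm x y)
    refine ⟨fun x y => γ x y * γ' x y * ⁅wordMap u y, wordMap v x⁆,
      fun x y => Ω.mul_mem (Ω.mul_mem (hm x y) (hm' x y)) (hcomm _ _), fun x x' y => ?_,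
      fun x y y' => ?_, fun x y => ?_⟩
    · simp only [hl, hl', hw', hcr (hm' _ _), commutatorElement_mul_right_of_center hc]
      calc _ = γ x y * (γ x' y * γ' x y) * (γ' x' y * ⁅wordMap u y, wordMap v x⁆) *
            ⁅wordMap u y, wordMap v x'⁆ := by group
        _ = _ := by rw [← hz' x' y, hz (hcomm _ _) (γ' x' y)]
                    rw [← mul_assoc, ← mul_assoc, mul_assoc _ (γ x' y), hz (hcomm _ _) (γ x' y)]
                    group
    · simp only [hr, hr', hw, hcl (hm _ _), commutatorElement_mul_left_of_center hc]
      calc _ = γ x y * (γ x y' * γ' x y) * (γ' x y' * ⁅wordMap u y, wordMap v x⁆) *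
            ⁅wordMap u y', wordMap v x⁆ := by group
        _ = _ := by rw [← hz' x y', hz (hcomm _ _) (γ' x y')]
                    rw [← mul_assoc, ← mul_assoc, mul_assoc _ (γ x y'), hz (hcomm _ _) (γ x y')]
                    group
    · have e : ∀ x : Fin k → G, wordMap (u * v) x = wordMap u x * wordMap v x := fun x => by
        simp [wordMap]
      have hs : wordMap u y * wordMap v x
          = wordMap v x * wordMap u y * ⁅wordMap u y, wordMap v x⁆ := by
        rw [hz (hcomm _ _), commutatorElement_def]; group
      rw [e, e, e, hw, hw']
      calc _ = wordMap u x * wordMap u y * (γ x y * (wordMap v x * wordMap v y)) * γ' x y := by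
            group
        _ = wordMap u x * (wordMap u y * wordMap v x) * wordMap v y * γ x y * γ' x y := by
            rw [← hz' x y]; group
        _ = wordMap u x * wordMap v x * wordMap u y *
              (⁅wordMap u y, wordMap v x⁆ * (wordMap v y * γ x y * γ' x y)) := by
            rw [hs]; group
        _ = _ := by rw [← hz (hcomm _ _)]; group

end Class2

section Exponents

/-- The exponent sum of the `i`-th variable in the word `w`. -/
def expSum {k : ℕ} (w : FreeGroup (Fin k)) (i : Fin k) : ℤ :=
  Multiplicative.toAdd (FreeGroup.lift (Pi.mulSingle i (Multiplicative.ofAdd (1 : ℤ))) w)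

theorem wordMap_mulSingle {G : Type*} [Group G] {k : ℕ} (w : FreeGroup (Fin k)) (i : Fin k)
    (t : G) : wordMap w (Pi.mulSingle i t) = t ^ expSum w i := by
  have h : (FreeGroup.lift (Pi.mulSingle i t) : FreeGroup (Fin k) →* G) =
      (zpowersHom G t).comp (FreeGroup.lift (Pi.mulSingle i (Multiplicative.ofAdd (1 : ℤ)))) := by
    ext j
    rcases eq_or_ne j i with rfl | hj
    · simp
    · simp [Pi.mulSingle_eq_of_ne hj]
  exact DFunLike.congr_fun h w

theorem map_wordMap {G H : Type*} [Group G] [Group H] (f : G →* H) {k : ℕ}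
    (w : FreeGroup (Fin k)) (x : Fin k → G) :
    f (wordMap w x) = wordMap w (fun i => f (x i)) := by
  have h : f.comp (FreeGroup.lift x) = FreeGroup.lift fun i => f (x i) := by ext; simp
  exact DFunLike.congr_fun h w

/-- The word map of a commutative group, as a homomorphism. -/
def wordHom {C : Type*} [CommGroup C] {k : ℕ} (w : FreeGroup (Fin k)) : (Fin k → C) →* C where
  toFun := wordMap w
  map_one' := by
    have h : (FreeGroup.lift (1 : Fin k → C)) = 1 := by ext; simp
    exact DFunLike.congr_fun h w
  map_mul' x y := by
    have h : (FreeGroup.lift (x * y)) = FreeGroup.lift x * FreeGroup.lift y := by ext; simp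
    exact DFunLike.congr_fun h w

theorem wordHom_mem_of_forall {C : Type*} [CommGroup C] {k : ℕ} (w : FreeGroup (Fin k))
    (Ω : Subgroup C) (h : ∀ (i : Fin k) (c : C), c ^ expSum w i ∈ Ω) (x : Fin k → C) :
    wordMap w x ∈ Ω := by
  change wordHom w x ∈ Ω
  rw [← Finset.univ_prod_mulSingle x, map_prod]
  refine Subgroup.prod_mem _ fun i _ => ?_
  change wordMap w _ ∈ Ω
  rw [wordMap_mulSingle]
  exact h i _

end Exponents

/-! ### Counting solutions by translation -/

section Counting

/-- If translation by `d : D` changes the value of `f` at `x` by `φ x d`, where `φ x` is a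
homomorphism depending only on the orbit of `x`, then each solution of `f = g` accounts for at
most `|A|` of the points whose orbit meets the solution set. -/
theorem card_orbits_meeting_le {H D G : Type*} [Group H] [Group D] [Group G] [Finite H] [Finite G]
    (A : Subgroup G) (ι : D →* H) (f : H → G) (φ : H → D →* A)
    (hf : ∀ x d, f (x * ι d) = f x * φ x d) (hφ : ∀ x d, φ (x * ι d) = φ x) (g : G) :
    Nat.card {x // ∃ d, f (x * ι d) = g} ≤ Nat.card {x // f x = g} * Nat.card A := by
  classical
  rw [← Nat.card_prod]
  let s : (D →* A) → A → D := fun ψ => Function.invFun ψ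
  have hs : ∀ (ψ : D →* A) (d : D), ψ (s ψ (ψ d)) = ψ d := fun ψ d =>
    Function.invFun_eq ⟨d, rfl⟩
  let F : {x // f x = g} × A → H := fun q => q.1 * ι (s (φ q.1) q.2)
  have hF : ∀ q, ∃ d, f (F q * ι d) = g := fun q =>
    ⟨(s (φ q.1) q.2)⁻¹, by simpa [F, mul_assoc, ← map_mul] using q.1.2⟩
  refine Nat.card_le_card_of_surjective (fun q => (⟨F q, hF q⟩ : {x // ∃ d, f (x * ι d) = g})) ?_
  rintro ⟨x, d, hd⟩
  have hx : φ (x * ι (s (φ x) (φ x d⁻¹))⁻¹) = φ x := hφ _ _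
  refine ⟨(⟨x * ι (s (φ x) (φ x d⁻¹))⁻¹, ?_⟩, φ x d⁻¹), ?_⟩
  · rw [hf, map_inv, hs, map_inv, inv_inv, ← hf, hd]
  · ext
    simp only [F, hx]
    rw [mul_assoc, ← map_mul, inv_mul_cancel, map_one, mul_one]

/-- A set stable under `ι D` which contains the points `κ y` for all `y` in a level set of a
homomorphism to `Ω` has at least `|H| / |Ω|` elements. -/
theorem card_le_mul_of_level_set {H D K Ω : Type*} [Group H] [Group D] [Group K] [Group Ω]
    [Finite H] [Finite Ω] (κ : K →* H) (ι : D →* H) (hgen : ∀ x, ∃ y d, x = κ y * ι d)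
    (P : H → Prop) (hP : ∀ x d, P x → P (x * ι d)) (Θ : K →* Ω) (y₀ : K)
    (h : ∀ y, Θ y = Θ y₀ → P (κ y)) :
    Nat.card H ≤ Nat.card {x // P x} * Nat.card Ω := by
  classical
  rw [← Nat.card_prod]
  refine Nat.card_le_card_of_surjective
    (fun q : {x // P x} × Ω => κ (Function.invFun Θ q.2) * (q.1 : H)) fun x => ?_
  obtain ⟨y, d, rfl⟩ := hgen x
  have hs : Θ (Function.invFun Θ (Θ (y * y₀⁻¹))) = Θ (y * y₀⁻¹) := Function.invFun_eq ⟨_, rfl⟩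
  refine ⟨(⟨κ ((Function.invFun Θ (Θ (y * y₀⁻¹)))⁻¹ * y) * ι d, hP _ _ (h _ ?_)⟩,
    Θ (y * y₀⁻¹)), ?_⟩
  · rw [map_mul, map_inv, hs, map_mul, map_inv]; group
  · simp [mul_assoc]

/-- If every value is taken on every line in the direction of the `i`-th coordinate, then each
solution of `f = g` accounts for at most `|G|` points. -/
theorem card_le_mul_of_surjective_coordinate {G : Type*} [Group G] [Finite G] {k : ℕ}
    (f : (Fin k → G) → G) (i : Fin k)
    (hf : ∀ x, Function.Surjective fun t : G => f (x * (Pi.mulSingle i t : Fin k → G))) (g : G) :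
    Nat.card (Fin k → G) ≤ Nat.card {x // f x = g} * Nat.card G := by
  rw [← Nat.card_prod]
  refine Nat.card_le_card_of_surjective
    (fun q : {x // f x = g} × G => (q.1 : Fin k → G) * (Pi.mulSingle i q.2)) fun x => ?_
  obtain ⟨t, ht⟩ := hf x g
  refine ⟨(⟨_, ht⟩, t⁻¹), ?_⟩
  simp [mul_assoc, ← Pi.mulSingle_mul]

theorem wordProb_ge_of_card_le {G : Type*} [Group G] [Finite G] {k : ℕ}
    (w : FreeGroup (Fin k)) (g : G)
    (h : Nat.card (Fin k → G) ≤ Nat.card {x : Fin k → G // wordMap w x = g} * Nat.card G) :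
    wordProb w g ≥ (Nat.card G : ℚ)⁻¹ := by
  have hG : (0 : ℚ) < Nat.card G := by exact_mod_cast Nat.card_pos
  rw [Nat.card_fun, Nat.card_fin] at h
  rw [wordProb, wordCount, ge_iff_le, inv_eq_one_div, div_le_div_iff₀ hG (by positivity), one_mul]
  exact_mod_cast h

end Counting

/-! ### Cyclic subgroups of prime power order -/

section Cyclic

variable {G : Type*} [Group G] [Finite G]

theorem mem_zpowers_of_pow_eq_one {a c d : G} (hc : c ∈ Subgroup.zpowers a)
    (hd : d ∈ Subgroup.zpowers a) (h : c ^ orderOf d = 1) : c ∈ Subgroup.zpowers d := by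
  classical
  have := Fintype.ofFinite G
  have hle := IsCyclic.card_pow_eq_one_le (α := Subgroup.zpowers a) (orderOf_pos d)
  let S : Finset (Subgroup.zpowers a) := Finset.univ.filter fun x => x ^ orderOf d = 1
  let T : Finset (Subgroup.zpowers a) := Finset.univ.filter fun x => (x : G) ∈ Subgroup.zpowers d
  have hTS : T ⊆ S := fun x hx => by
    simp only [T, S, Finset.mem_filter, Finset.mem_univ, true_and] at hx ⊢
    obtain ⟨m, hm⟩ := hx
    ext
    rw [Subgroup.coe_pow, ← hm]
    change (d ^ m) ^ orderOf d = 1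
    rw [← zpow_natCast, zpow_comm, zpow_natCast, pow_orderOf_eq_one, one_zpow]
  have hT : T.card = orderOf d := by
    rw [← Nat.card_zpowers d, ← Nat.card_eq_finsetCard]
    refine Nat.card_congr ⟨fun x => ⟨x.1, (Finset.mem_filter.mp x.2).2⟩,
      fun x => ⟨⟨x.1, (Subgroup.zpowers_le.mpr hd) x.2⟩, Finset.mem_filter.mpr
        ⟨Finset.mem_univ _, x.2⟩⟩, fun x => rfl, fun x => rfl⟩
  have hST : T = S := Finset.eq_of_subset_of_card_le hTS (hT ▸ hle)
  have : (⟨c, hc⟩ : Subgroup.zpowers a) ∈ T := by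
    rw [hST]
    exact Finset.mem_filter.mpr ⟨Finset.mem_univ _, Subtype.ext h⟩
  exact (Finset.mem_filter.mp this).2

theorem mem_zpowers_of_orderOf_le {p n : ℕ} (hp : p.Prime) {a c d : G} (ha : orderOf a = p ^ n)
    (hc : c ∈ Subgroup.zpowers a) (hd : d ∈ Subgroup.zpowers a) (h : orderOf c ≤ orderOf d) :
    c ∈ Subgroup.zpowers d := by
  refine mem_zpowers_of_pow_eq_one hc hd (orderOf_dvd_iff_pow_eq_one.mp ?_)
  obtain ⟨i, -, hi⟩ := (Nat.dvd_prime_pow hp).mp (ha ▸ orderOf_dvd_of_mem_zpowers hc)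
  obtain ⟨j, -, hj⟩ := (Nat.dvd_prime_pow hp).mp (ha ▸ orderOf_dvd_of_mem_zpowers hd)
  rw [hi, hj] at h ⊢
  exact Nat.pow_dvd_pow p ((Nat.pow_le_pow_iff_right hp.one_lt).mp h)

theorem mem_zpowers_of_pow_prime_eq_one {p n : ℕ} (hp : p.Prime) {a c d : G}
    (ha : orderOf a = p ^ n) (hc : c ∈ Subgroup.zpowers a) (hd : d ∈ Subgroup.zpowers a)
    (hcp : c ^ p = 1) (hd1 : d ≠ 1) : c ∈ Subgroup.zpowers d := by
  refine mem_zpowers_of_orderOf_le hp ha hc hd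
    ((Nat.le_of_dvd hp.pos (orderOf_dvd_of_pow_eq_one hcp)).trans ?_)
  obtain ⟨j, -, hj⟩ := (Nat.dvd_prime_pow hp).mp (ha ▸ orderOf_dvd_of_mem_zpowers hd)
  rw [hj]
  exact Nat.le_self_pow (by rintro rfl; exact hd1 (orderOf_eq_one_iff.mp (by simpa using hj))) p

end Cyclic

/-! ### Fibres of word maps -/

section Fibres

variable {G : Type*} [Group G] [Finite G]

/-- Modulo `Ω` this map is the bijection `t ↦ t ^ e`, and on cosets of `Ω` it is injective because
`δ`, having commutative target, is trivial on `Ω ≤ G'`. -/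
theorem surjective_zpow_mul_of_isCoprime {Ω : Subgroup G} (hcen : Ω ≤ Subgroup.center G)
    (hder : Ω ≤ commutator G) (δ : G →* Ω) {e : ℤ} (he : IsCoprime e (Nat.card G : ℤ)) :
    Function.Surjective fun t : G => t ^ e * (δ t : G) := by
  refine Finite.surjective_of_injective fun t s hts => ?_
  have hc : ∀ (c : Ω) (g : G), Commute g c := fun c g => mul_comm_of_mem_center (hcen c.2) g
  obtain ⟨f, q, hfq⟩ := he
  have hroot : ∀ g : G, g ^ (e * f) = g := fun g => by
    have : e * f = 1 - Nat.card G * q := by linarith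
    rw [this, zpow_sub, zpow_one, zpow_mul, zpow_natCast, pow_card_eq_one', one_zpow, inv_one,
      mul_one]
  have h1 : t * (δ t : G) ^ f = s * (δ s : G) ^ f := by
    have := congrArg (· ^ f) hts
    simpa only [(hc (δ _) _).mul_zpow, ← zpow_mul, hroot] using this
  have hker : ∀ c : Ω, δ c = 1 := fun c => by
    have : IsMulCommutative Ω := ⟨⟨fun x y => Subtype.ext (hc y x)⟩⟩
    exact Abelianization.commutator_subset_ker δ (hder c.2)
  have h2 : t = s * ((δ s ^ f * (δ t ^ f)⁻¹ : Ω) : G) := by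
    push_cast
    rw [← mul_assoc, ← h1, mul_inv_cancel_right]
  have h3 : δ t = δ s := by rw [h2, map_mul, hker, mul_one]
  rw [h3, mul_inv_cancel, Subgroup.coe_one, mul_one] at h2
  exact h2

/-- If one exponent sum of `w` is prime to `|G|`, all fibres of the word map have the same
size. -/
theorem card_le_of_isCoprime_expSum {Ω : Subgroup G} (hcen : Ω ≤ Subgroup.center G)
    (hder : Ω ≤ commutator G) (hcomm : ∀ u v : G, ⁅u, v⁆ ∈ Ω) {k : ℕ} (w : FreeGroup (Fin k))
    (i : Fin k) (hi : IsCoprime (expSum w i) (Nat.card G : ℤ)) (g : G) :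
    Nat.card (Fin k → G) ≤ Nat.card {x : Fin k → G // wordMap w x = g} * Nat.card G := by
  obtain ⟨γ, hm, -, hr, hw⟩ := exists_wordMap_mul_eq hcen hcomm w
  refine card_le_mul_of_surjective_coordinate (wordMap w) i (fun x y => ?_) g
  let δ : G →* Ω := MonoidHom.mk' (fun t => ⟨γ x (Pi.mulSingle i t), hm _ _⟩) fun t s =>
    Subtype.ext ((congrArg (γ x) (Pi.mulSingle_mul i t s)).trans (hr _ _ _))
  obtain ⟨t, ht⟩ := surjective_zpow_mul_of_isCoprime hcen hder δ hi ((wordMap w x)⁻¹ * y)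
  refine ⟨t, ?_⟩
  simp only [hw, wordMap_mulSingle, mul_assoc]
  rw [← eq_inv_mul_iff_mul_eq]
  exact ht

/-- Words all of whose exponent sums are divisible by `p`. Every element of
`G ^ k` is a product `y d` of tuples of powers of `b` and of `a`, and
`w (y d) = w (y) φ_y(d)` for a homomorphism `φ_y` with values in `⟨a⟩`. If the solution `y₀ d₀` has
`φ_{y₀}(d₀) = 1`, then the coset of every `y` with `w (y) = w (y₀)` contains a solution.
Otherwise the image of `φ_{y₀}` is generated by the image `u` of a single coordinate vector, and
hence contains `Ω`, being a nontrivial subgroup of a cyclic `p`-group; then the coset of `y`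
contains a solution as soon as `φ_y` takes the value `u` at the same vector. Both conditions describe level sets of homomorphisms
to `Ω`. -/
theorem card_le_of_dvd_expSum {p n : ℕ} (hp : p.Prime) {a b : G} (ha : orderOf a = p ^ n)
    (hgen : ∀ g : G, ∃ i j : ℤ, g = b ^ i * a ^ j) {Ω : Subgroup G}
    (hcen : Ω ≤ Subgroup.center G) (hΩa : Ω ≤ Subgroup.zpowers a) (hΩp : ∀ c ∈ Ω, c ^ p = 1)
    (hcomm : ∀ u v : G, ⁅u, v⁆ ∈ Ω) (hb : b ^ p ∈ Ω)
    (hcard : Nat.card Ω * orderOf a ≤ Nat.card G) {k : ℕ} (w : FreeGroup (Fin k))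
    (hw : ∀ i, (p : ℤ) ∣ expSum w i) (x₀ : Fin k → G) :
    Nat.card (Fin k → G) ≤
      Nat.card {x : Fin k → G // wordMap w x = wordMap w x₀} * Nat.card G := by
  classical
  set g := wordMap w x₀ with hg
  obtain ⟨γ, hm, hl, hr, hγ⟩ := exists_wordMap_mul_eq hcen hcomm w
  let A := Subgroup.zpowers a
  let B := Subgroup.zpowers b
  let ι : (Fin k → A) →* (Fin k → G) := A.subtype.compLeft (Fin k)
  let κ : (Fin k → B) →* (Fin k → G) := B.subtype.compLeft (Fin k)
  have hι : ∀ d, wordMap w (ι d) = (wordMap w d : A) := fun d =>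
    (map_wordMap A.subtype w d).symm
  have hκ : ∀ y, wordMap w (κ y) = (wordMap w y : B) := fun y =>
    (map_wordMap B.subtype w y).symm
  let Γ (x : Fin k → G) : (Fin k → A) →* A :=
    MonoidHom.mk' (fun d => ⟨γ x (ι d), hΩa (hm _ _)⟩) fun d d' =>
      Subtype.ext ((congrArg (γ x) (map_mul ι d d')).trans (hr _ _ _))
  let φ (x : Fin k → G) : (Fin k → A) →* A := wordHom w * Γ x
  have hφ : ∀ x d, wordMap w (x * ι d) = wordMap w x * φ x d := fun x d => by
    rw [hγ, hι, mul_assoc]; rfl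
  have hγ1 : ∀ d d', γ (ι d) (ι d') = 1 := fun d d' => by
    have h1 := hγ (ι d) (ι d')
    have h2 : wordMap w (d * d') = wordMap w d * wordMap w d' := map_mul (wordHom w) d d'
    rw [← map_mul, hι, hι, hι, h2, Subgroup.coe_mul] at h1
    exact left_eq_mul.mp h1
  have hφinv : ∀ x d, φ (x * ι d) = φ x := fun x d => by
    refine MonoidHom.ext fun d' => Subtype.ext ?_
    change ((wordMap w d' : A) : G) * γ (x * ι d) (ι d') = (wordMap w d' : A) * γ x (ι d')
    rw [hl, hγ1, mul_one]
  have hsplit : ∀ x, ∃ y d, x = κ y * ι d := fun x => by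
    choose i j hij using fun l => hgen (x l)
    exact ⟨fun l => ⟨b ^ i l, i l, rfl⟩, fun l => ⟨a ^ j l, j l, rfl⟩, funext hij⟩
  let P (x : Fin k → G) : Prop := ∃ d, wordMap w (x * ι d) = g
  have hP : ∀ x d, P x → P (x * ι d) := by
    rintro x d ⟨d', hd'⟩
    exact ⟨d⁻¹ * d', by rwa [mul_assoc, ← map_mul, mul_inv_cancel_left]⟩
  have h1 : Nat.card {x // P x} ≤ Nat.card {x // wordMap w x = g} * Nat.card A :=
    card_orbits_meeting_le A ι (wordMap w) φ hφ hφinv g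
  suffices h2 : Nat.card (Fin k → G) ≤ Nat.card {x // P x} * Nat.card Ω by
    calc _ ≤ _ := h2
      _ ≤ Nat.card {x // wordMap w x = g} * Nat.card A * Nat.card Ω := by gcongr
      _ = Nat.card {x // wordMap w x = g} * (Nat.card Ω * orderOf a) := by
        rw [← Nat.card_zpowers a]; ring
      _ ≤ _ := by gcongr
  have hwB : ∀ y : Fin k → B, ((wordMap w y : B) : G) ∈ Ω := fun y => by
    refine wordHom_mem_of_forall w (Ω.subgroupOf B) (fun i c => ?_) y
    obtain ⟨c, m, rfl⟩ := c
    obtain ⟨q, hq⟩ := hw i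
    rw [Subgroup.mem_subgroupOf, Subgroup.coe_zpow, hq]
    change (b ^ m) ^ ((p : ℤ) * q) ∈ Ω
    rw [← zpow_mul, mul_left_comm, zpow_mul, zpow_natCast, zpow_mul]
    exact Ω.zpow_mem (Ω.zpow_mem hb m) q
  obtain ⟨y₀, d₀, rfl⟩ := hsplit x₀
  rw [hφ] at hg
  by_cases h0 : φ (κ y₀) d₀ = 1
  · rw [h0, Subgroup.coe_one, mul_one] at hg
    let Θ : (Fin k → B) →* Ω := MonoidHom.mk' (fun y => ⟨(wordMap w y : B), hwB y⟩) fun y y' =>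
      Subtype.ext (congrArg (Subtype.val : B → G) (map_mul (wordHom w) y y'))
    refine card_le_mul_of_level_set κ ι hsplit P hP Θ y₀ fun y hy => ⟨1, ?_⟩
    rw [map_one, mul_one, hg, hκ, hκ]
    exact congrArg (Subtype.val : Ω → G) hy
  · let a' : A := ⟨a, Subgroup.mem_zpowers a⟩
    have hA : ∀ c : A, ∃ m : ℤ, a' ^ m = c := by
      rintro ⟨_, m, rfl⟩
      exact ⟨m, rfl⟩
    have ha' : orderOf a' = p ^ n := by rw [Subgroup.orderOf_mk, ha]
    have : Nonempty (Fin k) := by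
      by_contra hk
      rw [not_nonempty_iff] at hk
      exact h0 (by rw [Subsingleton.elim d₀ 1, map_one])
    -- the subgroups of `⟨a⟩` form a chain, so one coordinate vector generates the whole image
    obtain ⟨i, hi⟩ := Finite.exists_max fun i => orderOf (φ (κ y₀) (Pi.mulSingle i a'))
    set u := φ (κ y₀) (Pi.mulSingle i a') with hu
    have himg : ∀ d, φ (κ y₀) d ∈ Subgroup.zpowers u := fun d => by
      rw [← Finset.univ_prod_mulSingle d, map_prod]
      refine Subgroup.prod_mem _ fun j _ => ?_
      obtain ⟨m, hm⟩ := hA (d j)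
      rw [← hm, Pi.mulSingle_zpow, map_zpow]
      exact Subgroup.zpow_mem _ (mem_zpowers_of_orderOf_le hp ha' (hA _) (hA _) (hi j)) m
    have hu1 : u ≠ 1 := fun h => h0 (by simpa [h] using himg d₀)
    let Θ : (Fin k → B) →* Ω :=
      MonoidHom.mk' (fun y => ⟨γ (κ y) (ι (Pi.mulSingle i a')), hm _ _⟩) fun y y' =>
        Subtype.ext ((congrArg (γ · _) (map_mul κ y y')).trans (hl _ _ _))
    refine card_le_mul_of_level_set κ ι hsplit P hP Θ y₀ fun y hy => ?_
    have hyu : φ (κ y) (Pi.mulSingle i a') = u := Subtype.ext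
      (congrArg (fun c : Ω => ((wordMap w (Pi.mulSingle i a') : A) : G) * c) hy)
    have hcΩ : ((wordMap w y : B) : G)⁻¹ * (wordMap w y₀ : B) ∈ Ω :=
      Ω.mul_mem (Ω.inv_mem (hwB y)) (hwB y₀)
    have hc : (⟨_, hΩa hcΩ⟩ : A) ∈ Subgroup.zpowers u :=
      mem_zpowers_of_pow_prime_eq_one hp ha' (hA _) (hA _) (Subtype.ext (hΩp _ hcΩ)) hu1
    obtain ⟨m, hm⟩ := Subgroup.mul_mem _ hc (himg d₀)
    refine ⟨Pi.mulSingle i a' ^ m, ?_⟩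
    rw [hφ, map_zpow, hyu, hg, hκ, hκ]
    have hm' := congrArg Subtype.val hm
    simp only [Subgroup.coe_mul, Subgroup.coe_zpow] at hm' ⊢
    rw [hm', mul_assoc, mul_inv_cancel_left]

end Fibres

/-! ### Generators -/

section Generators

variable {G : Type*} [Group G]

/-- `a` and `b` generate a group of order `p ^ (n + 1)` and class two in which `a` generates a
subgroup of order `p ^ n` and `⁅b, a⁆ = a ^ p ^ (n - 1)`. The subgroup of order `p` of `⟨a⟩` is
then the commutator subgroup, and `b ^ p` lies in it. -/
structure IsModularPair (p n : ℕ) (a b : G) : Prop where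
  two_le : 2 ≤ n
  orderOf_eq : orderOf a = p ^ n
  card_eq : Nat.card G = p ^ (n + 1)
  comm_eq : ⁅b, a⁆ = a ^ p ^ (n - 1)
  mem_center : a ^ p ^ (n - 1) ∈ Subgroup.center G
  comm_mem : ∀ u v : G, ⁅u, v⁆ ∈ Subgroup.zpowers (a ^ p ^ (n - 1))
  pow_mem : b ^ p ∈ Subgroup.zpowers (a ^ p ^ (n - 1))

theorem orderOf_pow_prime_pow_pred {p n : ℕ} (hp : p.Prime) (hn : n ≠ 0) {a : G}
    (ha : orderOf a = p ^ n) : orderOf (a ^ p ^ (n - 1)) = p := by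
  obtain ⟨m, rfl⟩ := Nat.exists_eq_succ_of_ne_zero hn
  rw [orderOf_pow_of_dvd (pow_ne_zero _ hp.ne_zero) (ha ▸ pow_dvd_pow p (by simp)), ha]
  simp [pow_succ, hp.pos]

theorem exists_eq_zpow_mul_zpow {p : ℕ} [Fact p.Prime] {a x : G} [(Subgroup.zpowers a).Normal]
    (hi : (Subgroup.zpowers a).index = p) (hx : x ∉ Subgroup.zpowers a) (g : G) :
    ∃ i j : ℤ, g = x ^ i * a ^ j := by
  have hcard : Nat.card (G ⧸ Subgroup.zpowers a) = p := by rw [← Subgroup.index_eq_card, hi]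
  have h1 : (x : G ⧸ Subgroup.zpowers a) ≠ 1 := fun h => hx ((QuotientGroup.eq_one_iff x).mp h)
  obtain ⟨i, h2⟩ := mem_zpowers_of_prime_card hcard h1 (g' := (g : G ⧸ Subgroup.zpowers a))
  obtain ⟨j, hj⟩ := QuotientGroup.eq.mp ((QuotientGroup.mk_zpow _ x i).trans h2)
  exact ⟨i, j, by simp only at hj; rw [hj]; group⟩

namespace IsModularPair

variable {p n : ℕ} {a b : G}

theorem orderOf_pow_eq (h : IsModularPair p n a b) (hp : p.Prime) :
    orderOf (a ^ p ^ (n - 1)) = p :=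
  orderOf_pow_prime_pow_pred hp (by have := h.two_le; omega) h.orderOf_eq

theorem comm_mem_center (h : IsModularPair p n a b) (u v : G) : ⁅u, v⁆ ∈ Subgroup.center G :=
  Subgroup.zpowers_le.mpr h.mem_center (h.comm_mem u v)

theorem dvd_of_zpow_mem (h : IsModularPair p n a b) (hp : p.Prime) {i : ℤ}
    (hi : b ^ i ∈ Subgroup.zpowers a) : (p : ℤ) ∣ i := by
  rw [← h.orderOf_pow_eq hp, orderOf_dvd_iff_zpow_eq_one, ← h.comm_eq,
    ← commutatorElement_zpow_left_of_center h.comm_mem_center]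
  obtain ⟨j, hj⟩ := hi
  rw [show b ^ i = a ^ j from hj.symm]
  exact commutatorElement_eq_one_iff_mul_comm.mpr ((Commute.refl a).zpow_left j)

theorem exists_eq (h : IsModularPair p n a b) (hp : p.Prime) (g : G) :
    ∃ i j : ℤ, g = b ^ i * a ^ j := by
  have : Fact p.Prime := ⟨hp⟩
  have hN : (Subgroup.zpowers a).Normal := ⟨fun u hu g => by
    have : g * u * g⁻¹ = ⁅g, u⁆ * u := by rw [commutatorElement_def]; group
    rw [this]
    exact Subgroup.mul_mem _ (Subgroup.zpowers_le.mpr (Subgroup.npow_mem_zpowers a _)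
      (h.comm_mem g u)) hu⟩
  refine exists_eq_zpow_mul_zpow (p := p) ?_ (fun hb => ?_) g
  · have := (Subgroup.zpowers a).card_mul_index
    rw [Nat.card_zpowers, h.orderOf_eq, h.card_eq, pow_succ] at this
    exact Nat.eq_of_mul_eq_mul_left (pow_pos hp.pos n) this
  · have := h.dvd_of_zpow_mem hp (i := 1) (by rwa [zpow_one])
    exact hp.one_lt.ne' (by exact_mod_cast Int.eq_one_of_dvd_one (by positivity) this)

end IsModularPair

theorem IsModularPair.satisfiesAmitAshurst [Finite G] {p n : ℕ} (hp : p.Prime) {a b : G}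
    (h : IsModularPair p n a b) : SatisfiesAmitAshurst G := by
  rintro k w _ ⟨x₀, rfl⟩
  have hz := h.orderOf_pow_eq hp
  have hcen : Subgroup.zpowers (a ^ p ^ (n - 1)) ≤ Subgroup.center G :=
    Subgroup.zpowers_le.mpr h.mem_center
  refine wordProb_ge_of_card_le w _ ?_
  by_cases hw : ∀ i, (p : ℤ) ∣ expSum w i
  · refine card_le_of_dvd_expSum hp h.orderOf_eq (h.exists_eq hp) hcen
      (Subgroup.zpowers_le.mpr (Subgroup.npow_mem_zpowers a _)) ?_ h.comm_mem h.pow_mem ?_ w hw x₀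
    · rintro _ ⟨m, rfl⟩
      change ((a ^ p ^ (n - 1)) ^ m) ^ p = 1
      rw [← zpow_natCast, zpow_comm, zpow_natCast, orderOf_dvd_iff_pow_eq_one.mp hz.dvd, one_zpow]
    · rw [Nat.card_zpowers, hz, h.orderOf_eq, h.card_eq, pow_succ']
  · push Not at hw
    obtain ⟨i, hi⟩ := hw
    refine card_le_of_isCoprime_expSum hcen (Subgroup.zpowers_le.mpr ?_) h.comm_mem w i ?_ _
    · rw [← h.comm_eq]
      exact Subgroup.commutator_mem_commutator (Subgroup.mem_top _) (Subgroup.mem_top _)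
    · rw [h.card_eq, Nat.cast_pow]
      exact (((Nat.prime_iff_prime_int.mp hp).coprime_iff_not_dvd).mpr hi).symm.pow_right

theorem commutatorElement_mem_center_of_nilpotencyClass_eq_two [Group.IsNilpotent G]
    (h : Group.nilpotencyClass G = 2) (u v : G) : ⁅u, v⁆ ∈ Subgroup.center G := by
  have h2 := Subgroup.lowerCentralSeries_eq_bot_iff_nilpotencyClass_le.mpr h.le
  rw [Subgroup.mem_center_iff]
  intro g
  have : ⁅⁅u, v⁆, g⁆ ∈ (⊤ : Subgroup G).lowerCentralSeries 2 :=
    Subgroup.commutator_mem_commutator (Subgroup.commutator_mem_commutator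
      (Subgroup.mem_top _) (Subgroup.mem_top _)) (Subgroup.mem_top _)
  rw [h2, Subgroup.mem_bot, commutatorElement_eq_one_iff_mul_comm] at this
  exact this.symm

theorem normal_and_index_eq_of_isCoatom [Finite G] {p : ℕ} [Fact p.Prime] (hG : IsPGroup p G)
    {A : Subgroup G} (hA : IsCoatom A) : A.Normal ∧ A.index = p := by
  have := hG.isNilpotent
  have hN : A.Normal := Subgroup.NormalizerCondition.normal_of_coatom A
    Group.normalizerCondition_of_isNilpotent hA
  refine ⟨hN, ?_⟩
  have hne : A.index ≠ 1 := fun h => hA.1 (Subgroup.index_eq_one.mp h)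
  have hdvd : p ∣ Nat.card (G ⧸ A) :=
    ((hG.to_quotient A).card_eq_or_dvd).resolve_left (by rwa [← Subgroup.index_eq_card])
  obtain ⟨x, hx⟩ := exists_prime_orderOf_dvd_card' p hdvd
  obtain ⟨y, rfl⟩ := QuotientGroup.mk'_surjective A x
  have hlt : A < (Subgroup.zpowers (QuotientGroup.mk' A y)).comap (QuotientGroup.mk' A) := by
    refine lt_of_le_of_ne (fun g hg => ?_) fun h => ?_
    · rw [Subgroup.mem_comap, (QuotientGroup.eq_one_iff g).mpr hg |> fun h =>
        (show QuotientGroup.mk' A g = 1 from h)]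
      exact Subgroup.one_mem _
    · have hy : y ∈ A := by rw [h]; exact Subgroup.mem_zpowers _
      have h1 : QuotientGroup.mk' A y = 1 := (QuotientGroup.eq_one_iff y).mpr hy
      rw [h1, orderOf_one] at hx
      exact (Fact.out : p.Prime).one_lt.ne hx
  have htop := hA.2 _ hlt
  have htop' := congrArg (Subgroup.map (QuotientGroup.mk' A)) htop
  rw [Subgroup.map_comap_eq_self_of_surjective (QuotientGroup.mk'_surjective A),
    Subgroup.map_top_of_surjective _ (QuotientGroup.mk'_surjective A)] at htop'
  rw [Subgroup.index_eq_card, ← hx, ← Nat.card_zpowers, htop', Subgroup.card_top]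

/-- The generator `a` of the maximal subgroup is given. A power `b₀` of an element outside `⟨a⟩`
has the required commutator with `a`, and then `b₀ ^ p = a ^ (p * s)` for some `s`, because `b₀`
does not commute with `a`; the element `b = b₀ * a ^ (-s)` satisfies
`b ^ p = ⁅a ^ (-s), b₀⁆ ^ (p choose 2)`. -/
theorem exists_isModularPair [Finite G] {p : ℕ} [Fact p.Prime] (hG : IsPGroup p G)
    (hclass : Group.nilpotencyClass G = 2)
    (hmax : ∃ A : Subgroup G, IsCoatom A ∧ IsCyclic A) :
    ∃ (n : ℕ) (a b : G), IsModularPair p n a b ∧ (p ≠ 2 → b ^ p = 1) := by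
  have hp : p.Prime := Fact.out
  have := hG.isNilpotent
  have hc := commutatorElement_mem_center_of_nilpotencyClass_eq_two hclass
  obtain ⟨A, hA, hcyc⟩ := hmax
  obtain ⟨a, rfl⟩ := Subgroup.isCyclic_iff_exists_zpowers_eq_top A |>.mp hcyc
  obtain ⟨hN, hi⟩ := normal_and_index_eq_of_isCoatom hG hA
  obtain ⟨n, ha⟩ := IsPGroup.iff_orderOf.mp hG a
  have hgen := fun x hx => exists_eq_zpow_mul_zpow (x := x) hi hx
  have hpowA : ∀ u : G, u ^ p ∈ Subgroup.zpowers a := fun u =>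
    hi ▸ (Subgroup.zpowers a).pow_index_mem u
  have hAA : ∀ u ∈ Subgroup.zpowers a, ∀ v ∈ Subgroup.zpowers a, Commute u v := by
    rintro _ ⟨i, rfl⟩ _ ⟨j, rfl⟩
    exact ((Commute.refl a).zpow_zpow i j)
  have hcommA : ∀ u v : G, ⁅u, v⁆ ∈ Subgroup.zpowers a := fun u v => by
    have hcy : IsCyclic (G ⧸ Subgroup.zpowers a) :=
      isCyclic_of_prime_card (p := p) (by rw [← Subgroup.index_eq_card, hi])
    have hcom : IsMulCommutative (G ⧸ Subgroup.zpowers a) := inferInstance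
    exact Subgroup.Normal.quotient_commutative_iff_commutator_le.mp hcom
      (Subgroup.commutator_mem_commutator (Subgroup.mem_top _) (Subgroup.mem_top _))
  have hcommp : ∀ u v : G, ⁅u, v⁆ ^ p = 1 := fun u v => by
    by_cases hu : u ∈ Subgroup.zpowers a
    · rw [← commutatorElement_pow_right_of_center hc]
      exact commutatorElement_eq_one_iff_mul_comm.mpr (hAA _ hu _ (hpowA v))
    · rw [← commutatorElement_pow_left_of_center hc]
      obtain ⟨i, j, rfl⟩ := hgen u hu v
      exact commutatorElement_eq_one_iff_mul_comm.mpr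
        ((((Commute.refl u).pow_left p).zpow_right i).mul_right
          ((hAA _ (hpowA u) _ (Subgroup.mem_zpowers a)).zpow_right j))
  obtain ⟨x, hx⟩ : ∃ x, x ∉ Subgroup.zpowers a := by
    by_contra! h
    exact hA.1 ((Subgroup.eq_top_iff' _).mpr h)
  have hxa : ⁅x, a⁆ ≠ 1 := fun h => by
    have hxa' : Commute x a := commutatorElement_eq_one_iff_mul_comm.mp h
    have htop : Subgroup.center G = ⊤ := (Subgroup.eq_top_iff' _).mpr fun g => by
      rw [Subgroup.mem_center_iff]
      intro g'
      obtain ⟨i, j, rfl⟩ := hgen x hx g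
      obtain ⟨i', j', rfl⟩ := hgen x hx g'
      have h1 : ∀ i j : ℤ, Commute (x ^ i) (a ^ j) := fun i j => hxa'.zpow_zpow i j
      exact ((((Commute.refl x).zpow_zpow i' i).mul_right (h1 i' j)).mul_left
        ((h1 i j').symm.mul_right ((Commute.refl a).zpow_zpow j' j)))
    have := Subgroup.upperCentralSeries_eq_top_iff_nilpotencyClass_le (G := G) (n := 1) |>.mp
      (by rw [Subgroup.upperCentralSeries_one, htop])
    omega
  have hn0 : n ≠ 0 := by
    rintro rfl
    rw [pow_zero, orderOf_eq_one_iff] at ha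
    exact hxa (by rw [ha, commutatorElement_one_right])
  set z := a ^ p ^ (n - 1) with hz
  have hzo : orderOf z = p := orderOf_pow_prime_pow_pred hp hn0 ha
  have hz1 : z ≠ 1 := fun h => hp.one_lt.ne (by rw [← hzo, h, orderOf_one])
  have hzA : z ∈ Subgroup.zpowers a := Subgroup.npow_mem_zpowers a _
  obtain ⟨m, hm⟩ := mem_powers_iff_mem_zpowers.mpr
    (mem_zpowers_of_pow_prime_eq_one hp ha hzA (hcommA x a)
      (orderOf_dvd_iff_pow_eq_one.mp hzo.dvd) hxa)
  have hb₀ : ⁅x ^ m, a⁆ = z := (commutatorElement_pow_left_of_center hc x a m).trans hm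
  set b₀ := x ^ m
  have hzc : z ∈ Subgroup.center G := hb₀ ▸ hc _ _
  have hcommz : ∀ u v : G, ⁅u, v⁆ ∈ Subgroup.zpowers z := fun u v =>
    mem_zpowers_of_pow_prime_eq_one hp ha (hcommA u v) hzA (hcommp u v) hz1
  obtain ⟨t, ht⟩ := mem_powers_iff_mem_zpowers.mpr (hpowA b₀)
  obtain ⟨s, rfl⟩ : p ∣ t := by
    rw [← hzo]
    refine orderOf_dvd_of_pow_eq_one ?_
    rw [← hb₀, ← commutatorElement_pow_right_of_center hc]
    refine commutatorElement_eq_one_iff_mul_comm.mpr ?_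
    rw [show a ^ t = b₀ ^ p from ht]
    exact (Commute.refl b₀).pow_right p
  have hba : ⁅b₀ * (a⁻¹) ^ s, a⁆ = z := by
    rw [commutatorElement_mul_left_of_center hc, hb₀,
      commutatorElement_eq_one_iff_mul_comm.mpr
        (((Commute.refl a).inv_left).pow_left s), mul_one]
  have hbp : (b₀ * (a⁻¹) ^ s) ^ p = ⁅(a⁻¹) ^ s, b₀⁆ ^ p.choose 2 := by
    rw [mul_pow_of_commutator_center hc, ← show a ^ (p * s) = b₀ ^ p from ht, ← pow_mul, inv_pow,
      mul_comm s, mul_inv_cancel, one_mul]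
  refine ⟨n, a, b₀ * (a⁻¹) ^ s, ⟨?_, ha, ?_, hba, hzc, hcommz, ?_⟩, ?_⟩
  · by_contra hn
    obtain rfl : n = 1 := by omega
    rw [show z = a by simp [hz]] at hzc
    exact hz1 (hb₀ ▸ commutatorElement_eq_one_iff_mul_comm.mpr (mul_comm_of_mem_center hzc b₀))
  · rw [← (Subgroup.zpowers a).card_mul_index, hi, Nat.card_zpowers, ha, pow_succ]
  · rw [hbp]
    exact Subgroup.pow_mem _ (hcommz _ _) _
  · intro hp2
    obtain ⟨q, hq⟩ := hp.dvd_choose_self two_ne_zero (lt_of_le_of_ne hp.two_le hp2.symm)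
    rw [hbp, hq, pow_mul, hcommp, one_pow]

end Generators

/-! ### Identification of the group -/

section ModularIso

theorem exists_lift_eq_zpow_mul_zpow {M : Type*} [Group M] {p c : ℕ} (hp : p ≠ 0)
    (x : Fin 2 → M) (hpow : x 1 ^ p = 1) (hconj : x 1 * x 0 * (x 1)⁻¹ = x 0 ^ c)
    (w : FreeGroup (Fin 2)) : ∃ i j : ℤ, FreeGroup.lift x w = x 0 ^ i * x 1 ^ j := by
  let S (g : M) : Prop := ∀ i j : ℤ, ∃ i' j' : ℤ, g * (x 0 ^ i * x 1 ^ j) = x 0 ^ i' * x 1 ^ j'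
  have hmul : ∀ g h, S g → S h → S (g * h) := fun g h hg hh i j => by
    obtain ⟨i', j', e⟩ := hh i j
    obtain ⟨i'', j'', e'⟩ := hg i' j'
    exact ⟨i'', j'', by rw [mul_assoc, e, e']⟩
  have h0 : ∀ m : ℤ, S (x 0 ^ m) := fun m i j => ⟨m + i, j, by rw [zpow_add, mul_assoc]⟩
  have h1 : S (x 1) := fun i j => ⟨c * i, 1 + j, by
    have : x 1 * x 0 ^ i * (x 1)⁻¹ = x 0 ^ (c * i : ℤ) := by
      rw [← conj_zpow, hconj, zpow_mul, zpow_natCast]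
    rw [← this, zpow_add, zpow_one]; group⟩
  have h1n : ∀ m : ℕ, S (x 1 ^ m) := fun m => by
    induction m with
    | zero => exact fun i j => ⟨i, j, by simp⟩
    | succ m ih => rw [pow_succ]; exact hmul _ _ ih h1
  have h1i : S (x 1)⁻¹ := by
    have : (x 1)⁻¹ = x 1 ^ (p - 1) := by
      rw [inv_eq_iff_mul_eq_one, ← pow_succ', Nat.sub_add_cancel (Nat.pos_of_ne_zero hp), hpow]
    rw [this]
    exact h1n _
  have hS : S (FreeGroup.lift x w) := by
    induction w using FreeGroup.induction_on with
    | C1 => simpa using h0 0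
    | of i =>
      fin_cases i
      · simpa using h0 1
      · simpa using h1
    | inv_of i _ =>
      fin_cases i
      · simpa using h0 (-1)
      · simpa using h1i
    | mul u v hu hv => rw [map_mul]; exact hmul _ _ hu hv
  simpa using hS 0 0

/-- Elements of the presented group have the form `a ^ i * b ^ j`, and such an element is trivial
as soon as its image in `G` is. -/
theorem IsModularPair.nonempty_mulEquiv_modularGroup {G : Type*} [Group G] {p n : ℕ}
    (hp : p.Prime) {a b : G} (h : IsModularPair p n a b) (hb : b ^ p = 1) :
    Nonempty (G ≃* ModularGroup p n) := by
  let x : Fin 2 → G := ![a, b]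
  have hx : ∀ r ∈ modularRels p n, FreeGroup.lift x r = 1 := by
    rintro r (rfl | rfl | rfl)
    · simpa [x, h.orderOf_eq] using pow_orderOf_eq_one a
    · simpa [x] using hb
    · have : b * a * b⁻¹ = a ^ (1 + p ^ (n - 1)) := by
        rw [add_comm, pow_succ, ← h.comm_eq, commutatorElement_def]; group
      simp [x, this]
  let f : ModularGroup p n →* G := PresentedGroup.toGroup hx
  let y : Fin 2 → ModularGroup p n := fun i => PresentedGroup.of i
  have hf0 : f (y 0) = a := PresentedGroup.toGroup.of hx
  have hf1 : f (y 1) = b := PresentedGroup.toGroup.of hx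
  have hy : ∀ w, FreeGroup.lift y w = PresentedGroup.mk (modularRels p n) w := fun w => by
    have : FreeGroup.lift y = PresentedGroup.mk (modularRels p n) := by ext; simp [y]; rfl
    rw [this]
  have hrel : ∀ r ∈ modularRels p n, FreeGroup.lift y r = 1 := fun r hr => by
    rw [hy]; exact PresentedGroup.one_of_mem hr
  have hy0 : y 0 ^ p ^ n = 1 := by simpa using hrel _ (Or.inl rfl)
  have hy1 : y 1 ^ p = 1 := by simpa using hrel _ (Or.inr (Or.inl rfl))
  have hyc : y 1 * y 0 * (y 1)⁻¹ = y 0 ^ (1 + p ^ (n - 1)) := by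
    have := hrel _ (Or.inr (Or.inr rfl))
    simp only [map_mul, map_inv, map_pow, FreeGroup.lift_apply_of] at this
    exact mul_inv_eq_one.mp this
  refine ⟨(MulEquiv.ofBijective f ⟨?_, fun g => ?_⟩).symm⟩
  · rw [injective_iff_map_eq_one]
    intro g hg
    obtain ⟨w, rfl⟩ := PresentedGroup.mk_surjective _ g
    obtain ⟨i, j, hij⟩ := exists_lift_eq_zpow_mul_zpow hp.ne_zero y hy1 hyc w
    rw [hy] at hij
    rw [hij, map_mul, map_zpow, map_zpow, hf0, hf1] at hg
    obtain ⟨q, rfl⟩ := h.dvd_of_zpow_mem hp (i := j)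
      ⟨-i, by rw [← inv_eq_of_mul_eq_one_right hg]; exact zpow_neg a i⟩
    rw [zpow_mul, zpow_natCast, hb, one_zpow, mul_one] at hg
    obtain ⟨m, rfl⟩ := orderOf_dvd_iff_zpow_eq_one.mpr hg
    rw [hij, h.orderOf_eq, zpow_mul, zpow_natCast, hy0, zpow_mul, zpow_natCast, hy1, one_zpow,
      one_zpow, mul_one]
  · obtain ⟨i, j, rfl⟩ := h.exists_eq hp g
    exact ⟨y 1 ^ i * y 0 ^ j, by rw [map_mul, map_zpow, map_zpow, hf0, hf1]⟩

end ModularIso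

section TwoGroups

variable {G : Type*} [Group G]

/-- For `n ≥ 3` the element `b` may be multiplied by a square root of the involution of `⟨a⟩`,
which commutes with `b`. -/
theorem IsModularPair.exists_sq_eq_one {n : ℕ} {a b : G} (h : IsModularPair 2 n a b)
    (hn : 3 ≤ n) (hb : b ^ 2 = a ^ 2 ^ (n - 1)) :
    ∃ b' : G, IsModularPair 2 n a b' ∧ b' ^ 2 = 1 := by
  have hc := h.comm_mem_center
  have hz2 : (a ^ 2 ^ (n - 1)) ^ 2 = 1 :=
    orderOf_dvd_iff_pow_eq_one.mp (h.orderOf_pow_eq Nat.prime_two).dvd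
  have hsq : (a ^ 2 ^ (n - 2)) ^ 2 = a ^ 2 ^ (n - 1) := by
    rw [← pow_mul, ← pow_succ]; congr 2; omega
  have hcomm : ⁅a ^ 2 ^ (n - 2), b⁆ = 1 := by
    rw [commutatorElement_pow_left_of_center hc, ← commutatorElement_inv, h.comm_eq, inv_pow,
      show n - 2 = n - 3 + 1 by omega, pow_succ' 2, pow_mul, hz2, one_pow, inv_one]
  have hb' : (b * a ^ 2 ^ (n - 2)) ^ 2 = 1 := by
    rw [mul_pow_of_commutator_center hc, hcomm, hb, hsq, one_pow, mul_one, ← sq, hz2]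
  refine ⟨b * a ^ 2 ^ (n - 2), ⟨h.two_le, h.orderOf_eq, h.card_eq, ?_, h.mem_center, h.comm_mem,
    hb' ▸ Subgroup.one_mem _⟩, hb'⟩
  rw [commutatorElement_mul_left_of_center hc, h.comm_eq,
    commutatorElement_eq_one_iff_mul_comm.mpr ((Commute.refl a).pow_left _), mul_one]

theorem IsModularPair.nonempty_mulEquiv_quaternionGroup [Finite G] {a b : G}
    (h : IsModularPair 2 2 a b) (hb : b ^ 2 = a ^ 2) :
    Nonempty (G ≃* QuaternionGroup 2) := by
  have ha4 : a ^ 4 = 1 := by simpa [h.orderOf_eq] using pow_orderOf_eq_one a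
  have hba : b * a * b⁻¹ = a⁻¹ := by
    have h1 : b * a * b⁻¹ = a ^ 3 := by
      have := h.comm_eq
      rw [commutatorElement_def, mul_inv_eq_iff_eq_mul] at this
      rw [this]; simp [pow_succ]
    rw [h1, eq_inv_iff_mul_eq_one, ← pow_succ, ha4]
  let ψ : ZMod (2 * 2) →+ Additive G := ZMod.lift (2 * 2) ⟨zmultiplesHom _ (Additive.ofMul a), by
    change ((2 * 2 : ℕ) : ℤ) • Additive.ofMul a = 0
    rw [natCast_zsmul, ← ofMul_pow]
    exact congrArg Additive.ofMul ha4⟩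
  let P (i : ZMod (2 * 2)) : G := (ψ i).toMul
  have hP : ∀ m : ℤ, P m = a ^ m := fun m => by
    change (ψ m).toMul = _
    rw [ZMod.lift_coe]
    rfl
  have hadd : ∀ i j, P (i + j) = P i * P j := fun i j => by simp only [P, map_add, toMul_add]
  have hPb : ∀ i, P i * b = b * P (-i) := fun i => by
    obtain ⟨m, rfl⟩ := ZMod.intCast_surjective i
    have e : a ^ m = b * a ^ (-m) * b⁻¹ := by rw [← conj_zpow, hba, inv_zpow', neg_neg]
    rw [← Int.cast_neg, hP, hP]
    exact eq_mul_inv_iff_mul_eq.mp e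
  have hP1 : P 1 = a := by simpa using hP 1
  have hP0 : P 0 = 1 := by simpa using hP 0
  have hP2 : P ((2 : ℕ) : ZMod (2 * 2)) = b * b := by
    exact (hP 2).trans (by rw [← sq, hb, zpow_ofNat])
  let f : QuaternionGroup 2 →* G :=
    MonoidHom.mk' (fun q => match q with
      | .a i => P i
      | .xa i => b * P i) (by
      rintro (i | i) (j | j)
      · exact hadd i j
      · change b * P (j - i) = P i * (b * P j)
        rw [← mul_assoc, hPb, mul_assoc, ← hadd, sub_eq_neg_add]
      · change b * P (i + j) = b * P i * P j
        rw [hadd, mul_assoc]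
      · change P (((2 : ℕ) : ZMod (2 * 2)) + j - i) = b * P i * (b * P j)
        rw [mul_assoc, ← mul_assoc (P i), hPb, mul_assoc, ← hadd, ← mul_assoc, ← hP2, ← hadd]
        congr 1; ring)
  have hsurj : Function.Surjective f := fun g => by
    obtain ⟨i, j, rfl⟩ := h.exists_eq Nat.prime_two g
    refine ⟨QuaternionGroup.xa 0 ^ i * QuaternionGroup.a 1 ^ j, ?_⟩
    have e1 : f (QuaternionGroup.xa 0) = b := by
      change b * P 0 = b
      rw [hP0, mul_one]
    have e2 : f (QuaternionGroup.a 1) = a := hP1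
    rw [map_mul, map_zpow, map_zpow, e1, e2]
  have hcard : Nat.card (QuaternionGroup 2) ≤ Nat.card G := by
    rw [h.card_eq, Nat.card_eq_fintype_card, QuaternionGroup.card]
    norm_num
  exact ⟨(MulEquiv.ofBijective f (hsurj.bijective_of_nat_card_le hcard)).symm⟩

end TwoGroups

theorem mainTheorem2 (p : ℕ) [Fact p.Prime] (G : Type*) [Group G] [Finite G]
    (hG : IsPGroup p G) (hclass : Group.nilpotencyClass G = 2)
    (hmax : ∃ A : Subgroup G, IsCoatom A ∧ IsCyclic A) :
    SatisfiesAmitAshurst G ∧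
      (Nonempty (G ≃* QuaternionGroup 2) ∨
        ∃ n : ℕ, 2 ≤ n ∧ Nonempty (G ≃* ModularGroup p n)) := by
  have hp : p.Prime := Fact.out
  obtain ⟨n, a, b, h, hodd⟩ := exists_isModularPair hG hclass hmax
  refine ⟨h.satisfiesAmitAshurst hp, ?_⟩
  by_cases hb : b ^ p = 1
  · exact Or.inr ⟨n, h.two_le, h.nonempty_mulEquiv_modularGroup hp hb⟩
  obtain rfl : p = 2 := by
    by_contra hp2
    exact hb (hodd hp2)
  -- the only nontrivial element of a group of order two is its generator
  have hb2 : b ^ 2 = a ^ 2 ^ (n - 1) := by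
    obtain ⟨m, hm⟩ := h.pow_mem
    have hz : (a ^ 2 ^ (n - 1)) ^ 2 = 1 :=
      orderOf_dvd_iff_pow_eq_one.mp (h.orderOf_pow_eq hp).dvd
    have hm' : (a ^ 2 ^ (n - 1)) ^ m = b ^ 2 := hm
    rcases Int.even_or_odd' m with ⟨q, rfl | rfl⟩
    · rw [zpow_mul, zpow_ofNat, hz, one_zpow] at hm'
      exact absurd hm'.symm hb
    · rw [zpow_add_one, zpow_mul, zpow_ofNat, hz, one_zpow, one_mul] at hm'
      exact hm'.symm
  rcases h.two_le.eq_or_lt with rfl | hn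
  · exact Or.inl (h.nonempty_mulEquiv_quaternionGroup hb2)
  · obtain ⟨b', h', hb'⟩ := h.exists_sq_eq_one hn hb2
    exact Or.inr ⟨n, h.two_le, h'.nonempty_mulEquiv_modularGroup hp hb'⟩
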